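/- For real $\nu>0$ and $x\in(0,1/2)$ let $$F_\nu(x)={}_3F_2\!\left(x-\tfrac12,\,x+\tfrac12,\,x+\tfrac32;\ 2x+1,\,x+\nu+\tfrac12;\ 1\right)=\sum_{n=0}^{\infty}\frac{(x-\frac12)_n\,(x+\frac12)_n\,(x+\frac32)_n}{n!\,(2x+1)_n\,(x+\nu+\frac12)_n},$$ where $(a)_n=a(a+1)\cdots(a+n-1)$; this series converges absolutely. For all sufficiently small $\nu>0$, the function $F_\nu$ has exactly one zero $x_0(\nu)$ in the interval $(0,1/2)$, and, as $\nu\to0+$, $$x_0(\nu)=\frac12-\nu-\nu^2-\left(2-\frac{\pi^2}{6}\right)\nu^3-\left(5-\frac{\pi^2}{3}-\zeta(3)\right)\nu^4+O(\nu^5),$$ where $\zeta$ is the Riemann zeta function. -/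

import Mathlib

open Filter Topology Asymptotics

/-- The `n`-th term `(a₁)ₙ (a₂)ₙ (a₃)ₙ / (n! (b₁)ₙ (b₂)ₙ)` of the hypergeometric series `₃F₂` at
unit argument, where `(a)ₙ = a (a + 1) ⋯ (a + n - 1)`. -/
noncomputable def hyp3F2Term (a₁ a₂ a₃ b₁ b₂ : ℝ) (n : ℕ) : ℝ :=
  ((ascPochhammer ℝ n).eval a₁ * (ascPochhammer ℝ n).eval a₂ * (ascPochhammer ℝ n).eval a₃) /
    ((n.factorial : ℝ) * (ascPochhammer ℝ n).eval b₁ * (ascPochhammer ℝ n).eval b₂)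

/-- The unit argument hypergeometric function `₃F₂(a₁, a₂, a₃; b₁, b₂; 1)`, with real parameters. -/
noncomputable def hyp3F2 (a₁ a₂ a₃ b₁ b₂ : ℝ) : ℝ :=
  ∑' n : ℕ, hyp3F2Term a₁ a₂ a₃ b₁ b₂ n

/-- The `n`-th term of the series `₃F₂(x - 1/2, x + 1/2, x + 3/2; 2x + 1, x + ν + 1/2; 1)`. -/
noncomputable def charTerm (ν x : ℝ) (n : ℕ) : ℝ :=
  hyp3F2Term (x - 1 / 2) (x + 1 / 2) (x + 3 / 2) (2 * x + 1) (x + ν + 1 / 2) n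

/-- The function `x ↦ ₃F₂(x - 1/2, x + 1/2, x + 3/2; 2x + 1, x + ν + 1/2; 1)`. -/
noncomputable def charFun3F2 (ν x : ℝ) : ℝ :=
  hyp3F2 (x - 1 / 2) (x + 1 / 2) (x + 3 / 2) (2 * x + 1) (x + ν + 1 / 2)

/-! Write x = 1/2 - e, R = `pochRatio e v`, W = `pochWeight e`. Since (-e)ₙ = -e (1 - e)ₙ / (n - e),
the n-th term of the series is -e Rₙ Wₙ / (n - e). The parameter excess of the series is v, so it
degenerates as v → 0. But v Rₙ₊₁ / (n + 1 - e) = Rₙ - Rₙ₊₁, and summation by parts against W gives v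
F = v - (e - e² (1 - e) T), where T = `partsSum e v` is dominated by ∑ 1/(n + 1)² uniformly down to
v = 0 (`sum_charTerm`, `hasSum_charTerm`). Zeros of F are thus solutions of `zeroEqn v e = v`; its
left side is continuous and strictly increasing in e on [0, 1/2], which gives existence and
uniqueness for v < 1/4.

For the asymptotics put t = e - v, which is O(e²) at a zero. Expanding the logarithm of each term of
T to second order in e and first order in t gives T = 1 + (1 - ζ(2)) e + (2ζ(2) - ζ(3)) e² + t +
O(e³) (`exists_abs_partsSum_sub_le`). The coefficients are series in harmonic numbers which
telescope up to ζ(2), ζ(3) and Euler's sum. Since t = e² + O(e³), v is a quartic in e up to O(e⁵)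
(`exists_abs_sub_quartic_le`), and inverting it (`isBigO_sub_of_quartic`) yields the claim. -/

/-! ### Bounds and monotonicity for the reduced series. -/

/-- The ratio `(1 - e)ₙ / (1 - e + v)ₙ`. -/
noncomputable def pochRatio (e v : ℝ) (n : ℕ) : ℝ :=
  ∏ k ∈ Finset.range n, ((k + 1 - e) / (k + 1 - e + v))

/-- The ratio `(1 - e)ₙ (2 - e)ₙ / (n! (2 - 2e)ₙ)`. -/
noncomputable def pochWeight (e : ℝ) (n : ℕ) : ℝ :=
  ∏ k ∈ Finset.range n, (((k + 1 - e) * (k + 2 - e)) / ((k + 1) * (k + 2 - 2 * e)))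

/-- The `n`-th term of the series left over by a summation by parts. -/
noncomputable def partsTerm (e v : ℝ) (n : ℕ) : ℝ :=
  pochRatio e v n * pochWeight e n / ((n + 1) * (n + 2 - 2 * e))

/-- The series left over by a summation by parts. -/
noncomputable def partsSum (e v : ℝ) : ℝ := ∑' n, partsTerm e v n

lemma pochRatio_succ (e v : ℝ) (n : ℕ) :
    pochRatio e v (n + 1) = pochRatio e v n * ((n + 1 - e) / (n + 1 - e + v)) :=
  Finset.prod_range_succ _ _

lemma pochWeight_succ (e : ℝ) (n : ℕ) :
    pochWeight e (n + 1) =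
      pochWeight e n * (((n + 1 - e) * (n + 2 - e)) / ((n + 1) * (n + 2 - 2 * e))) :=
  Finset.prod_range_succ _ _

lemma pochRatio_pos {e v : ℝ} (he : e ≤ 1 / 2) (hv : 0 ≤ v) (n : ℕ) : 0 < pochRatio e v n := by
  refine Finset.prod_pos fun k _ => ?_
  have : (0 : ℝ) ≤ k := k.cast_nonneg
  exact div_pos (by linarith) (by linarith)

lemma pochWeight_pos {e : ℝ} (he : e ≤ 1 / 2) (n : ℕ) : 0 < pochWeight e n := by
  refine Finset.prod_pos fun k _ => ?_
  have : (0 : ℝ) ≤ k := k.cast_nonneg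
  exact div_pos (mul_pos (by linarith) (by linarith)) (mul_pos (by linarith) (by linarith))

lemma pochRatio_anti {a b v : ℝ} (hab : a ≤ b) (hb : b ≤ 1 / 2) (hv : 0 ≤ v) (n : ℕ) :
    pochRatio b v n ≤ pochRatio a v n := by
  refine Finset.prod_le_prod (fun k _ => ?_) fun k _ => ?_ <;>
    have : (0 : ℝ) ≤ k := k.cast_nonneg
  · exact div_nonneg (by linarith) (by linarith)
  · rw [div_le_div_iff₀ (by linarith) (by linarith)]
    nlinarith [mul_nonneg hv (sub_nonneg.2 hab)]

/-- Each factor is 1 - e (1 - e) / ((k + 1) (k + 2 - 2e)), and on [0, 1/2] the subtracted fraction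
grows with e. -/
lemma pochWeight_anti {a b : ℝ} (ha : 0 ≤ a) (hab : a ≤ b) (hb : b ≤ 1 / 2) (n : ℕ) :
    pochWeight b n ≤ pochWeight a n := by
  have key : ∀ (k : ℕ) (e : ℝ), e ≤ 1 / 2 →
      ((k + 1 - e) * (k + 2 - e)) / ((k + 1) * (k + 2 - 2 * e)) =
        1 - e * (1 - e) / ((k + 1) * (k + 2 - 2 * e)) := by
    intro k e he
    have : (0 : ℝ) ≤ k := k.cast_nonneg
    have h2 : (k : ℝ) + 2 * (1 - e) ≠ 0 := by linarith
    have h3 : (k : ℝ) + 2 - 2 * e = k + 2 * (1 - e) := by ring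
    rw [h3]
    field_simp
    ring
  refine Finset.prod_le_prod (fun k _ => ?_) fun k _ => ?_ <;>
    have hk : (0 : ℝ) ≤ k := k.cast_nonneg
  · exact div_nonneg (mul_nonneg (by linarith) (by linarith))
      (mul_nonneg (by linarith) (by linarith))
  · rw [key k b hb, key k a (hab.trans hb)]
    refine sub_le_sub_left (div_le_div₀ (mul_nonneg (by linarith) (by linarith)) ?_
      (mul_pos (by linarith) (by linarith)) ?_) _
    · nlinarith
    · exact mul_le_mul_of_nonneg_left (by linarith) (by linarith)

lemma pochRatio_le_one {e v : ℝ} (he : e ≤ 1 / 2) (hv : 0 ≤ v) (n : ℕ) : pochRatio e v n ≤ 1 := by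
  refine Finset.prod_le_one (fun k _ => ?_) fun k _ => ?_ <;>
    have : (0 : ℝ) ≤ k := k.cast_nonneg
  · exact div_nonneg (by linarith) (by linarith)
  · exact div_le_one_of_le₀ (by linarith) (by linarith)

lemma pochWeight_le_one {e : ℝ} (h0 : 0 ≤ e) (he : e ≤ 1 / 2) (n : ℕ) : pochWeight e n ≤ 1 := by
  refine (pochWeight_anti le_rfl h0 he n).trans (le_of_eq (Finset.prod_eq_one fun k _ => ?_))
  have : (0 : ℝ) ≤ k := k.cast_nonneg
  simp only [sub_zero, mul_zero]
  exact div_self (by positivity)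

lemma hasSum_inv_succ_sq : HasSum (fun n : ℕ => 1 / ((n : ℝ) + 1) ^ 2) (Real.pi ^ 2 / 6) := by
  have h := (hasSum_nat_add_iff' 1).2 hasSum_zeta_two
  simpa using h

lemma pi_sq_div_six_lt : Real.pi ^ 2 / 6 < 5 / 3 := by
  nlinarith [Real.pi_lt_d2, Real.pi_pos]

lemma partsTerm_nonneg {e v : ℝ} (he : e ≤ 1 / 2) (hv : 0 ≤ v) (n : ℕ) : 0 ≤ partsTerm e v n := by
  have : (0 : ℝ) ≤ n := n.cast_nonneg
  exact div_nonneg (mul_nonneg (pochRatio_pos he hv n).le (pochWeight_pos he n).le)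
    (mul_nonneg (by linarith) (by linarith))

lemma pochRatio_mul_pochWeight_le_one {e v : ℝ} (h0 : 0 ≤ e) (he : e ≤ 1 / 2) (hv : 0 ≤ v)
    (n : ℕ) : pochRatio e v n * pochWeight e n ≤ 1 :=
  mul_le_one₀ (pochRatio_le_one he hv n) (pochWeight_pos he n).le (pochWeight_le_one h0 he n)

lemma partsTerm_le {e v : ℝ} (h0 : 0 ≤ e) (he : e ≤ 1 / 2) (hv : 0 ≤ v) (n : ℕ) :
    partsTerm e v n ≤ 1 / ((n : ℝ) + 1) ^ 2 := by
  have : (0 : ℝ) ≤ n := n.cast_nonneg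
  refine div_le_div₀ zero_le_one (pochRatio_mul_pochWeight_le_one h0 he hv n) (by positivity) ?_
  nlinarith

lemma summable_partsTerm {e v : ℝ} (h0 : 0 ≤ e) (he : e ≤ 1 / 2) (hv : 0 ≤ v) :
    Summable (partsTerm e v) :=
  Summable.of_nonneg_of_le (partsTerm_nonneg he hv) (partsTerm_le h0 he hv)
    hasSum_inv_succ_sq.summable

lemma partsSum_nonneg {e v : ℝ} (he : e ≤ 1 / 2) (hv : 0 ≤ v) : 0 ≤ partsSum e v :=
  tsum_nonneg (partsTerm_nonneg he hv)

lemma partsSum_le {e v : ℝ} (h0 : 0 ≤ e) (he : e ≤ 1 / 2) (hv : 0 ≤ v) :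
    partsSum e v ≤ 5 / 3 :=
  (((summable_partsTerm h0 he hv).tsum_le_tsum (partsTerm_le h0 he hv)
    hasSum_inv_succ_sq.summable).trans_eq hasSum_inv_succ_sq.tsum_eq).trans pi_sq_div_six_lt.le

/-- The product R W decreases in e, so only the denominator can make a term grow, by at most 2 (b -
a) / (n + 1)³. This is below (b - a) / (n + 1)² except at n = 0, where the extra 1 is needed; the
total stays under (ζ(2) + 1) (b - a) < 8/3 (b - a). -/
lemma partsTerm_sub_le {a b v : ℝ} (ha : 0 ≤ a) (hab : a ≤ b) (hb : b ≤ 1 / 2) (hv : 0 ≤ v)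
    (n : ℕ) : partsTerm b v n - partsTerm a v n ≤
      (b - a) * (1 / ((n : ℝ) + 1) ^ 2 + if n = 0 then 1 else 0) := by
  have hn : (0 : ℝ) ≤ n := n.cast_nonneg
  have h1 : 0 < (n : ℝ) + 2 - 2 * b := by linarith
  have h2 : 0 < (n : ℝ) + 2 - 2 * a := by linarith
  have hE : pochRatio b v n * pochWeight b n ≤ pochRatio a v n * pochWeight a n :=
    mul_le_mul (pochRatio_anti hab hb hv n) (pochWeight_anti ha hab hb n)
      (pochWeight_pos hb n).le (pochRatio_pos (hab.trans hb) hv n).le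
  have hE1 := pochRatio_mul_pochWeight_le_one ha (hab.trans hb) hv n
  have hE0 : 0 ≤ pochRatio a v n * pochWeight a n :=
    mul_nonneg (pochRatio_pos (hab.trans hb) hv n).le (pochWeight_pos (hab.trans hb) n).le
  unfold partsTerm
  calc _ ≤ pochRatio a v n * pochWeight a n / ((n + 1) * (n + 2 - 2 * b))
        - pochRatio a v n * pochWeight a n / ((n + 1) * (n + 2 - 2 * a)) := by
        gcongr
    _ = pochRatio a v n * pochWeight a n *
          (2 * (b - a) / ((n + 1) * ((n + 2 - 2 * b) * (n + 2 - 2 * a)))) := by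
        field_simp
        ring
    _ ≤ 1 * (2 * (b - a) / ((n + 1) * ((n + 1) * (n + 1)))) := by
        refine mul_le_mul hE1 ?_ (by have := sub_nonneg.2 hab; positivity) zero_le_one
        refine div_le_div_of_nonneg_left (by linarith) (by positivity) ?_
        gcongr <;> linarith
    _ = (b - a) * (2 / ((n : ℝ) + 1) ^ 3) := by ring
    _ ≤ _ := by
        refine mul_le_mul_of_nonneg_left ?_ (sub_nonneg.2 hab)
        rcases Nat.eq_zero_or_pos n with rfl | hpos
        · norm_num
        · rw [if_neg hpos.ne', add_zero, div_le_div_iff₀ (by positivity) (by positivity)]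
          have : (1 : ℝ) ≤ n := by exact_mod_cast hpos
          nlinarith [sq_nonneg ((n : ℝ) + 1)]

lemma partsSum_sub_le {a b v : ℝ} (ha : 0 ≤ a) (hab : a ≤ b) (hb : b ≤ 1 / 2) (hv : 0 ≤ v) :
    partsSum b v - partsSum a v ≤ 8 / 3 * (b - a) := by
  have hs := ((hasSum_inv_succ_sq.add (hasSum_ite_eq (0 : ℕ) (1 : ℝ))).mul_left (b - a))
  have h := hasSum_le (partsTerm_sub_le ha hab hb hv)
    ((summable_partsTerm (ha.trans hab) hb hv).hasSum.sub
      (summable_partsTerm ha (hab.trans hb) hv).hasSum) hs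
  refine h.trans ?_
  nlinarith [pi_sq_div_six_lt, sub_nonneg.2 hab]

/-! ### The reduced equation: monotonicity and solvability. -/

/-- The left-hand side of the equation for the zeros. -/
noncomputable def zeroEqn (v e : ℝ) : ℝ := e - e ^ 2 * (1 - e) * partsSum e v

/-- The increment splits into the variation of e² (1 - e) and that of T. With a + b - a² - ab - b² ≤
1/3 (maximum at a = b = 1/3), T ≤ 5/3, a² (1 - a) ≤ 4/27 and Lipschitz bound 8/3, the slope is at
least 1 - 5/9 - 32/81 = 4/81. -/
lemma zeroEqn_strictMonoOn {v : ℝ} (hv : 0 ≤ v) :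
    StrictMonoOn (zeroEqn v) (Set.Icc 0 (1 / 2)) := by
  rintro a ⟨ha, -⟩ b ⟨-, hb⟩ hab
  have h1 := partsSum_sub_le ha hab.le hb hv
  have h2 := partsSum_le (ha.trans hab.le) hb hv
  have h3 := partsSum_nonneg hb hv
  have hd : 0 < b - a := sub_pos.2 hab
  have h4 : a + b - a ^ 2 - a * b - b ^ 2 ≤ 1 / 3 := by
    nlinarith [sq_nonneg (a - b), sq_nonneg (a + b - 2 / 3)]
  have h5 : a ^ 2 * (1 - a) ≤ 4 / 27 := by
    nlinarith [mul_nonneg (sq_nonneg (a - 2 / 3)) (by linarith : (0 : ℝ) ≤ a + 1 / 3)]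
  have h6 : 0 ≤ a ^ 2 * (1 - a) := mul_nonneg (sq_nonneg a) (by linarith)
  have e1 : a ^ 2 * (1 - a) * (partsSum b v - partsSum a v) ≤ 4 / 27 * (8 / 3 * (b - a)) :=
    (mul_le_mul_of_nonneg_left h1 h6).trans
      (mul_le_mul_of_nonneg_right h5 (by positivity))
  have e2 : (a + b - a ^ 2 - a * b - b ^ 2) * partsSum b v ≤ 1 / 3 * (5 / 3) :=
    (mul_le_mul_of_nonneg_right h4 h3).trans (mul_le_mul_of_nonneg_left h2 (by norm_num))
  have e3 : (b - a) * ((a + b - a ^ 2 - a * b - b ^ 2) * partsSum b v) ≤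
      (b - a) * (1 / 3 * (5 / 3)) := mul_le_mul_of_nonneg_left e2 hd.le
  have : zeroEqn v b - zeroEqn v a = (b - a)
      - (b - a) * ((a + b - a ^ 2 - a * b - b ^ 2) * partsSum b v)
      - a ^ 2 * (1 - a) * (partsSum b v - partsSum a v) := by
    unfold zeroEqn; ring
  linarith

lemma continuousOn_partsSum {v : ℝ} (hv : 0 ≤ v) :
    ContinuousOn (fun e => partsSum e v) (Set.Icc 0 (1 / 2)) := by
  refine continuousOn_tsum (u := fun n : ℕ => 1 / ((n : ℝ) + 1) ^ 2) (fun n => ?_)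
    hasSum_inv_succ_sq.summable ?_
  · have hk : ∀ (k : ℕ), (0 : ℝ) ≤ k := fun k => k.cast_nonneg
    unfold partsTerm pochRatio pochWeight
    refine ContinuousOn.div (ContinuousOn.mul ?_ ?_) (by fun_prop) ?_
    · refine continuousOn_finsetProd _ fun k _ => ContinuousOn.div (by fun_prop) (by fun_prop) ?_
      rintro e ⟨-, he⟩
      linarith [hk k]
    · refine continuousOn_finsetProd _ fun k _ => ContinuousOn.div (by fun_prop) (by fun_prop) ?_
      rintro e ⟨-, he⟩
      exact mul_ne_zero (by linarith [hk k]) (by linarith [hk k])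
    · rintro e ⟨-, he⟩
      exact mul_ne_zero (by linarith [hk n]) (by linarith [hk n])
  · rintro n e ⟨h0, he⟩
    rw [Real.norm_of_nonneg (partsTerm_nonneg he hv n)]
    exact partsTerm_le h0 he hv n

lemma exists_zeroEqn_eq {v : ℝ} (hv : 0 < v) (hv' : v < 1 / 4) :
    ∃ e ∈ Set.Ioo (0 : ℝ) (1 / 2), zeroEqn v e = v := by
  have hc : ContinuousOn (zeroEqn v) (Set.Icc 0 (1 / 2)) := by
    have := continuousOn_partsSum hv.le
    unfold zeroEqn
    fun_prop
  -- At e = 1/2 the bound T ≤ 5/3 gives a value of at least 1/2 - 5/24 = 7/24 > 1/4.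
  refine intermediate_value_Ioo (by norm_num) hc ⟨?_, ?_⟩
  · simpa [zeroEqn] using hv
  · have := partsSum_le (v := v) (by norm_num : (0 : ℝ) ≤ 1 / 2) le_rfl hv.le
    unfold zeroEqn
    linarith

/-! ### Summation by parts: from the hypergeometric series to the reduced equation. -/

lemma charTerm_eq {e v : ℝ} (h0 : 0 < e) (he : e < 1 / 2) (hv : 0 ≤ v) (n : ℕ) :
    charTerm v (1 / 2 - e) n = -e * (pochRatio e v n * pochWeight e n) / (n - e) := by
  have aux : ∀ n : ℕ, (n : ℝ) - e ≠ 0 := by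
    intro n
    rcases Nat.eq_zero_or_pos n with rfl | h
    · simpa using h0.ne'
    · have : (1 : ℝ) ≤ n := by exact_mod_cast h
      linarith
  induction n with
  | zero => simp [charTerm, hyp3F2Term, pochRatio, pochWeight, h0.ne']
  | succ n ih =>
    have hn : (0 : ℝ) ≤ n := n.cast_nonneg
    have hsucc : charTerm v (1 / 2 - e) (n + 1) = charTerm v (1 / 2 - e) n *
        (((n - e) * (n + 1 - e) * (n + 2 - e)) /
          ((n + 1) * (n + 2 - 2 * e) * (n + 1 - e + v))) := by
      unfold charTerm hyp3F2Term
      simp only [ascPochhammer_succ_eval, Nat.factorial_succ]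
      rw [div_mul_div_comm]
      push_cast
      congr 1 <;> ring
    have h1 := aux n
    have h2 := aux (n + 1)
    have h3 : (n : ℝ) + 2 - 2 * e ≠ 0 := by linarith
    have h4 : (n : ℝ) + 1 - e + v ≠ 0 := by linarith
    push_cast at h2
    rw [hsucc, ih, pochRatio_succ, pochWeight_succ]
    push_cast
    field_simp

/-- Abel summation of (Rₙ - Rₙ₊₁) Wₙ₊₁, using Wₙ - Wₙ₊₁ = e (1 - e) Wₙ / ((n + 1) (n + 2 - 2e)). -/
lemma sum_charTerm {e v : ℝ} (h0 : 0 < e) (he : e < 1 / 2) (hv : 0 ≤ v) (N : ℕ) :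
    v * ∑ n ∈ Finset.range (N + 1), charTerm v (1 / 2 - e) n =
      v - e * (1 - pochRatio e v N * pochWeight e N
        - e * (1 - e) * ∑ n ∈ Finset.range N, partsTerm e v n) := by
  induction N with
  | zero => simp [charTerm, hyp3F2Term, pochRatio, pochWeight]
  | succ N ih =>
    have hn : (0 : ℝ) ≤ N := N.cast_nonneg
    have h1 : (N : ℝ) + 1 - e ≠ 0 := by linarith
    obtain ⟨d, hd⟩ : ∃ d : ℝ, d = N + 2 - 2 * e := ⟨_, rfl⟩
    have h3 : d ≠ 0 := by linarith
    have h4 : (N : ℝ) + 1 - e + v ≠ 0 := by linarith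
    rw [Finset.sum_range_succ, mul_add, ih, Finset.sum_range_succ, charTerm_eq h0 he hv,
      pochRatio_succ, pochWeight_succ]
    generalize ∑ n ∈ Finset.range N, partsTerm e v n = S
    unfold partsTerm
    push_cast
    rw [← hd]
    field_simp
    rw [hd]
    ring

/-- The reciprocal is a product of factors 1 + v / (k + 1 - e), hence at least 1 plus v times a
harmonic sum, which diverges. -/
lemma tendsto_pochRatio {e v : ℝ} (h0 : 0 ≤ e) (he : e ≤ 1 / 2) (hv : 0 < v) :
    Tendsto (pochRatio e v) atTop (𝓝 0) := by
  have key : ∀ n, 1 + v * ∑ k ∈ Finset.range n, 1 / ((k : ℝ) + 1) ≤ (pochRatio e v n)⁻¹ := by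
    intro n
    induction n with
    | zero => simp [pochRatio]
    | succ n ih =>
      have hn : (0 : ℝ) ≤ n := n.cast_nonneg
      have hs : 0 ≤ ∑ k ∈ Finset.range n, 1 / ((k : ℝ) + 1) :=
        Finset.sum_nonneg fun k _ => by positivity
      have h1 : 0 < (n : ℝ) + 1 - e := by linarith
      have e1 : ((n + 1 - e) / (n + 1 - e + v))⁻¹ = 1 + v * (1 / ((n : ℝ) + 1 - e)) := by
        rw [inv_div]; field_simp
      have e2 : 1 / ((n : ℝ) + 1) ≤ 1 / ((n : ℝ) + 1 - e) :=
        one_div_le_one_div_of_le h1 (by linarith)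
      rw [pochRatio_succ, mul_inv, e1, Finset.sum_range_succ]
      have e3 : 0 ≤ 1 / ((n : ℝ) + 1) := by positivity
      calc 1 + v * (∑ k ∈ Finset.range n, 1 / ((k : ℝ) + 1) + 1 / ((n : ℝ) + 1))
          ≤ (1 + v * ∑ k ∈ Finset.range n, 1 / ((k : ℝ) + 1)) * (1 + v * (1 / ((n : ℝ) + 1))) := by
            nlinarith [mul_nonneg (mul_nonneg hv.le hs) (mul_nonneg hv.le e3)]
        _ ≤ _ := by
            gcongr
            exact inv_nonneg.2 (pochRatio_pos he hv.le n).le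
  have h1 : Tendsto (fun n => (pochRatio e v n)⁻¹) atTop atTop :=
    tendsto_atTop_mono key (tendsto_atTop_add_const_left _ _
      (Real.tendsto_sum_range_one_div_nat_succ_atTop.const_mul_atTop hv))
  refine h1.inv_tendsto_atTop.congr fun n => ?_
  simp

lemma hasSum_charTerm {e v : ℝ} (h0 : 0 < e) (he : e < 1 / 2) (hv : 0 < v) :
    HasSum (charTerm v (1 / 2 - e)) ((v - zeroEqn v e) / v) := by
  -- Only the term n = 0 is positive. Once it is split off, the negated tail is nonnegative, so
  -- convergence of partial sums suffices.
  rw [← hasSum_nat_add_iff' 1]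
  suffices h : HasSum (fun n => -charTerm v (1 / 2 - e) (n + 1))
      (-((v - zeroEqn v e) / v - ∑ i ∈ Finset.range 1, charTerm v (1 / 2 - e) i)) by
    simpa using h.neg
  rw [hasSum_iff_tendsto_nat_of_nonneg]
  · have hE : Tendsto (fun N => pochRatio e v N * pochWeight e N) atTop (𝓝 0) :=
      squeeze_zero (fun n => mul_nonneg (pochRatio_pos he.le hv.le n).le (pochWeight_pos he.le n).le)
        (fun n => mul_le_of_le_one_right (pochRatio_pos he.le hv.le n).le
          (pochWeight_le_one h0.le he.le n)) (tendsto_pochRatio h0.le he.le hv)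
    have hT := (summable_partsTerm h0.le he.le hv.le).hasSum.tendsto_sum_nat
    have hlim := (((((hE.const_sub 1).sub (hT.const_mul (e * (1 - e)))).const_mul e).const_sub
      v).div_const v).sub_const (charTerm v (1 / 2 - e) 0)
    refine (hlim.neg.congr fun N => ?_).trans_eq ?_
    · rw [← sum_charTerm h0 he hv.le, mul_div_cancel_left₀ _ hv.ne', Finset.sum_range_succ',
        add_sub_cancel_right, Finset.sum_neg_distrib]
    · unfold zeroEqn partsSum
      simp only [Finset.sum_range_one]
      congr 3
      ring
  · intro n
    have hn : (0 : ℝ) ≤ n := n.cast_nonneg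
    rw [charTerm_eq h0 he hv.le, neg_mul, neg_div, neg_neg]
    push_cast
    exact div_nonneg (mul_nonneg h0.le (mul_nonneg (pochRatio_pos he.le hv.le _).le
      (pochWeight_pos he.le _).le)) (by linarith)

lemma charFun3F2_eq_zero_iff {e v : ℝ} (h0 : 0 < e) (he : e < 1 / 2) (hv : 0 < v) :
    charFun3F2 v (1 / 2 - e) = 0 ↔ zeroEqn v e = v := by
  have : charFun3F2 v (1 / 2 - e) = (v - zeroEqn v e) / v := (hasSum_charTerm h0 he hv).tsum_eq
  rw [this, div_eq_zero_iff, or_iff_left hv.ne', sub_eq_zero, eq_comm]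

lemma summable_charTerm {v x : ℝ} (hv : 0 < v) (hx : x ∈ Set.Ioo (0 : ℝ) (1 / 2)) :
    Summable (charTerm v x) := by
  have := (hasSum_charTerm (e := 1 / 2 - x) (by linarith [hx.2]) (by linarith [hx.1]) hv).summable
  simpa using this

lemma zeroEqn_of_charFun3F2_eq_zero {v x : ℝ} (hv : 0 < v) (hx : x ∈ Set.Ioo (0 : ℝ) (1 / 2))
    (h : charFun3F2 v x = 0) : zeroEqn v (1 / 2 - x) = v := by
  rw [← charFun3F2_eq_zero_iff (by linarith [hx.2]) (by linarith [hx.1]) hv]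
  simpa using h

lemma existsUnique_zero {v : ℝ} (hv : 0 < v) (hv' : v < 1 / 4) :
    ∃! x : ℝ, x ∈ Set.Ioo (0 : ℝ) (1 / 2) ∧ charFun3F2 v x = 0 := by
  obtain ⟨e, ⟨h0, he⟩, hz⟩ := exists_zeroEqn_eq hv hv'
  refine ⟨1 / 2 - e, ⟨⟨by linarith, by linarith⟩, (charFun3F2_eq_zero_iff h0 he hv).2 hz⟩, ?_⟩
  rintro y ⟨hy, hy0⟩
  have := (zeroEqn_strictMonoOn hv.le).injOn (x₁ := 1 / 2 - y) (x₂ := e)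
    ⟨by linarith [hy.2], by linarith [hy.1]⟩ ⟨h0.le, he.le⟩
    ((zeroEqn_of_charFun3F2_eq_zero hv hy hy0).trans hz.symm)
  linarith

/-! ### Growth of harmonic sums. -/

/-- The power sum `∑_{k = 1}^n 1 / k ^ s`. -/
noncomputable def harm (s n : ℕ) : ℝ := ∑ k ∈ Finset.range n, 1 / ((k : ℝ) + 1) ^ s

lemma harm_zero (s : ℕ) : harm s 0 = 0 := Finset.sum_range_zero _

lemma harm_succ (s n : ℕ) : harm s (n + 1) = harm s n + 1 / ((n : ℝ) + 1) ^ s :=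
  Finset.sum_range_succ _ _

lemma harm_nonneg (s n : ℕ) : 0 ≤ harm s n := Finset.sum_nonneg fun k _ => by positivity

lemma harm_two_le (n : ℕ) : harm 2 n ≤ 5 / 3 :=
  (hasSum_inv_succ_sq.summable.sum_le_tsum _ fun k _ => by positivity).trans
    (hasSum_inv_succ_sq.tsum_eq.trans_le pi_sq_div_six_lt.le)

/-- The exponent 1/6 makes the cube O(n^(1/2)), so (1 + Hₙ)³ / ((n + 1) (n + 2)) is a summable
majorant for the error terms. -/
lemma one_add_harm_le (n : ℕ) : 1 + harm 1 n ≤ 8 * ((n : ℝ) + 1) ^ (1 / 6 : ℝ) := by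
  have h1 : harm 1 n ≤ 1 + Real.log (n + 1) := by
    have h := harmonic_le_one_add_log n
    have e : ((harmonic n : ℚ) : ℝ) = harm 1 n := by
      simp [harmonic, harm]
    rw [e] at h
    rcases Nat.eq_zero_or_pos n with rfl | hn
    · simp [harm_zero]
    · have : Real.log n ≤ Real.log (n + 1) :=
        Real.log_le_log (by exact_mod_cast hn) (by linarith)
      linarith
  have h2 := Real.log_le_rpow_div (x := (n : ℝ) + 1) (by positivity)
    (by norm_num : (0 : ℝ) < 1 / 6)
  have h3 : (1 : ℝ) ≤ ((n : ℝ) + 1) ^ (1 / 6 : ℝ) :=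
    Real.one_le_rpow (by linarith [n.cast_nonneg (α := ℝ)]) (by norm_num)
  linarith

lemma summable_harm_cube :
    Summable fun n : ℕ => (1 + harm 1 n) ^ 3 / (((n : ℝ) + 1) * (n + 2)) := by
  have hs : Summable fun n : ℕ => 512 * (((n + 1 : ℕ) : ℝ) ^ (-(3 / 2) : ℝ)) :=
    ((summable_nat_add_iff 1).2 (Real.summable_nat_rpow.2 (by norm_num))).mul_left _
  refine hs.of_nonneg_of_le (fun n => ?_) fun n => ?_
  · have := harm_nonneg 1 n
    positivity
  · have hn : (0 : ℝ) < n + 1 := by positivity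
    have h0 := harm_nonneg 1 n
    have h1 : (1 + harm 1 n) ^ 3 ≤ 512 * ((n : ℝ) + 1) ^ (1 / 2 : ℝ) := by
      refine (pow_le_pow_left₀ (by positivity) (one_add_harm_le n) 3).trans_eq ?_
      rw [mul_pow, ← Real.rpow_natCast (((n : ℝ) + 1) ^ (1 / 6 : ℝ)), ← Real.rpow_mul hn.le]
      norm_num
    have h2 : ((n : ℝ) + 1) ^ (1 / 2 : ℝ) = ((n : ℝ) + 1) ^ (-(3 / 2) : ℝ) * ((n : ℝ) + 1) ^ 2 := by
      rw [← Real.rpow_natCast, ← Real.rpow_add hn]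
      norm_num
    rw [div_le_iff₀ (by positivity)]
    refine h1.trans ?_
    rw [h2, ← mul_assoc]
    push_cast
    have h3 : 0 ≤ 512 * ((n : ℝ) + 1) ^ (-(3 / 2) : ℝ) := by positivity
    exact mul_le_mul_of_nonneg_left (by nlinarith) h3

lemma summable_of_le_harm_cube {f : ℕ → ℝ} (C : ℝ)
    (hf : ∀ n : ℕ, |f n| ≤ C * ((1 + harm 1 n) ^ 3 / (((n : ℝ) + 1) * (n + 2)))) : Summable f :=
  Summable.of_norm_bounded (summable_harm_cube.mul_left C) hf

/-- The real value `ζ(3)`. -/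
noncomputable def zetaThree : ℝ := ∑' n : ℕ, 1 / ((n : ℝ) + 1) ^ 3

lemma hasSum_zetaThree : HasSum (fun n : ℕ => 1 / ((n : ℝ) + 1) ^ 3) zetaThree := by
  have h : Summable fun n : ℕ => 1 / (n : ℝ) ^ 3 := Real.summable_one_div_nat_pow.2 (by norm_num)
  have := (summable_nat_add_iff 1).2 h
  push_cast at this
  exact this.hasSum

lemma riemannZeta_three_re : (riemannZeta 3).re = zetaThree := by
  have h := zeta_nat_eq_tsum_of_gt_one (k := 3) (by norm_num)
  have e : ∑' n : ℕ, 1 / (n : ℂ) ^ 3 = ((∑' n : ℕ, 1 / (n : ℝ) ^ 3 : ℝ) : ℂ) := by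
    push_cast; rfl
  have h2 : ∑' n : ℕ, 1 / (n : ℝ) ^ 3 = zetaThree := by
    refine HasSum.tsum_eq ?_
    rw [← hasSum_nat_add_iff' 1]
    simpa using hasSum_zetaThree
  rw [e, h2] at h
  have h3 : riemannZeta 3 = (zetaThree : ℂ) := by exact_mod_cast h
  rw [h3, Complex.ofReal_re]

lemma tendsto_inv_succ : Tendsto (fun n : ℕ => 1 / ((n : ℝ) + 1)) atTop (𝓝 0) :=
  tendsto_one_div_add_atTop_nhds_zero_nat

lemma tendsto_harm_sq_div : Tendsto (fun n : ℕ => harm 1 n ^ 2 / ((n : ℝ) + 1)) atTop (𝓝 0) := by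
  have h : Tendsto (fun n : ℕ => 64 * ((n : ℝ) + 1) ^ (-(2 / 3) : ℝ)) atTop (𝓝 0) := by
    have := ((tendsto_rpow_neg_atTop (by norm_num : (0 : ℝ) < 2 / 3)).comp
      (tendsto_atTop_add_const_right _ (1 : ℝ) tendsto_natCast_atTop_atTop)).const_mul 64
    simpa using this
  refine squeeze_zero (fun n => by positivity) (fun n => ?_) h
  have hn : (0 : ℝ) < n + 1 := by positivity
  have h1 : harm 1 n ^ 2 ≤ 64 * ((n : ℝ) + 1) ^ (1 / 3 : ℝ) := by
    refine (pow_le_pow_left₀ (harm_nonneg 1 n)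
      ((le_add_of_nonneg_left zero_le_one).trans (one_add_harm_le n)) 2).trans_eq ?_
    rw [mul_pow, ← Real.rpow_natCast (((n : ℝ) + 1) ^ (1 / 6 : ℝ)), ← Real.rpow_mul hn.le]
    norm_num
  have h2 : ((n : ℝ) + 1) ^ (1 / 3 : ℝ) = ((n : ℝ) + 1) ^ (-(2 / 3) : ℝ) * ((n : ℝ) + 1) := by
    nth_rewrite 3 [← Real.rpow_one ((n : ℝ) + 1)]
    rw [← Real.rpow_add hn]
    norm_num
  rw [div_le_iff₀ hn]
  refine h1.trans_eq ?_
  rw [h2, mul_assoc]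

lemma tendsto_harm_div : Tendsto (fun n : ℕ => harm 1 n / ((n : ℝ) + 1)) atTop (𝓝 0) := by
  have h := tendsto_harm_sq_div.add tendsto_inv_succ
  rw [add_zero] at h
  refine squeeze_zero (fun n => div_nonneg (harm_nonneg 1 n) (by positivity)) (fun n => ?_) h
  rw [← add_div]
  exact div_le_div_of_nonneg_right (by nlinarith [sq_nonneg (harm 1 n - 1)]) (by positivity)

lemma tendsto_harm_two_div : Tendsto (fun n : ℕ => harm 2 n / ((n : ℝ) + 1)) atTop (𝓝 0) := by
  have h := tendsto_inv_succ.const_mul (5 / 3)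
  rw [mul_zero] at h
  refine squeeze_zero (fun n => div_nonneg (harm_nonneg 2 n) (by positivity)) (fun n => ?_) h
  rw [mul_one_div]
  exact div_le_div_of_nonneg_right (harm_two_le n) (by positivity)

/-! ### Evaluation of the harmonic series. -/

lemma hasSum_telescope {f : ℕ → ℝ} (hf : Summable fun n => f n - f (n + 1))
    (h : Tendsto f atTop (𝓝 0)) : HasSum (fun n => f n - f (n + 1)) (f 0) := by
  rw [hf.hasSum_iff_tendsto_nat]
  simp only [Finset.sum_range_sub']
  simpa using h.const_sub (f 0)

lemma summable_harm_div_sq : Summable fun n : ℕ => harm 1 n / ((n : ℝ) + 1) ^ 2 := by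
  refine summable_of_le_harm_cube 2 fun n => ?_
  have h0 := harm_nonneg 1 n
  rw [abs_of_nonneg (by positivity), ← mul_div_assoc, div_le_div_iff₀ (by positivity) (by positivity)]
  have e1 : harm 1 n ≤ (1 + harm 1 n) ^ 3 := by nlinarith [pow_nonneg h0 3, sq_nonneg (harm 1 n)]
  have e2 : ((n : ℝ) + 1) * (n + 2) ≤ 2 * (n + 1) ^ 2 := by
    nlinarith [n.cast_nonneg (α := ℝ)]
  calc _ ≤ (1 + harm 1 n) ^ 3 * (2 * (n + 1) ^ 2) :=
        mul_le_mul e1 e2 (by positivity) (by positivity)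
    _ = _ := by ring

/-- By partial fractions with shift m + 1, the partial sums telescope to Hₘ₊₁ minus a window of m +
1 reciprocals that moves off to infinity. -/
lemma hasSum_inv_mul_shift (m : ℕ) :
    HasSum (fun n : ℕ => 1 / (((n : ℝ) + 1) * (m + n + 2))) (harm 1 (m + 1) / (m + 1)) := by
  have hnn : ∀ n : ℕ, (0 : ℝ) ≤ 1 / (((n : ℝ) + 1) * (m + n + 2)) := fun n => by positivity
  rw [hasSum_iff_tendsto_nat_of_nonneg hnn]
  have key : ∀ N : ℕ, ∑ n ∈ Finset.range N, 1 / (((n : ℝ) + 1) * (m + n + 2)) =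
      (harm 1 (m + 1) - ∑ k ∈ Finset.range (m + 1), 1 / (((N + k : ℕ) : ℝ) + 1)) / (m + 1) := by
    intro N
    induction N with
    | zero => simp [harm]
    | succ N ih =>
      rw [Finset.sum_range_succ, ih]
      have e : ∑ k ∈ Finset.range (m + 1), 1 / (((N + 1 + k : ℕ) : ℝ) + 1) =
          ∑ k ∈ Finset.range (m + 1), 1 / (((N + k : ℕ) : ℝ) + 1)
            + 1 / ((m : ℝ) + N + 2) - 1 / ((N : ℝ) + 1) := by
        have h1 := Finset.sum_range_succ' (fun k => 1 / (((N + k : ℕ) : ℝ) + 1)) (m + 1)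
        rw [Finset.sum_range_succ] at h1
        have h2 : ∀ k : ℕ, N + 1 + k = N + (k + 1) := fun k => by ring
        simp only [h2]
        have h3 : (((N + (m + 1) : ℕ) : ℝ) + 1) = (m : ℝ) + N + 2 := by push_cast; ring
        rw [h3] at h1
        simp only [add_zero] at h1
        linarith
      rw [e]
      field_simp
      ring
  simp only [key]
  have h0 : Tendsto (fun N : ℕ => ∑ k ∈ Finset.range (m + 1), 1 / (((N + k : ℕ) : ℝ) + 1)) atTop
      (𝓝 0) := by
    have := tendsto_finsetSum (Finset.range (m + 1)) fun k _ =>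
      tendsto_inv_succ.comp (tendsto_add_atTop_nat k)
    simpa using this
  simpa using (h0.const_sub (harm 1 (m + 1))).div_const ((m : ℝ) + 1)

/-- Euler's sum `∑ Hₙ / (n + 1)² = ζ(3)`. -/
lemma hasSum_harm_div_sq : HasSum (fun n : ℕ => harm 1 n / ((n : ℝ) + 1) ^ 2) zetaThree := by
  set S := ∑' n : ℕ, harm 1 n / ((n : ℝ) + 1) ^ 2 with hS
  have hs : HasSum (fun n : ℕ => harm 1 n / ((n : ℝ) + 1) ^ 2) S := summable_harm_div_sq.hasSum
  -- Summing this double series by rows gives S + ζ(3) and by antidiagonals gives 2S, whence S =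
  -- ζ(3).
  let f : ℕ × ℕ → ℝ := fun p => 1 / (((p.1 : ℝ) + 1) * ((p.2 + 1) * (p.1 + p.2 + 2)))
  have hrow : ∀ m : ℕ, HasSum (fun n => f (m, n)) (harm 1 (m + 1) / (m + 1) ^ 2) := by
    intro m
    have := (hasSum_inv_mul_shift m).mul_left (1 / ((m : ℝ) + 1))
    convert! this using 1
    · ext n; simp only [f]; field_simp
    · field_simp
  have hrows : HasSum (fun m : ℕ => harm 1 (m + 1) / ((m : ℝ) + 1) ^ 2) (S + zetaThree) := by
    convert! hs.add hasSum_zetaThree using 1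
    ext m
    rw [harm_succ]
    field_simp
  have hf : Summable f := by
    rw [summable_prod_of_nonneg (fun p => by simp only [f, Pi.zero_apply]; positivity)]
    exact ⟨fun m => (hrow m).summable, by simpa only [(hrow _).tsum_eq] using hrows.summable⟩
  have h1 : ∑' p, f p = S + zetaThree := by
    rw [hf.tsum_prod' fun m => (hrow m).summable]
    simpa only [(hrow _).tsum_eq] using hrows.tsum_eq
  have hdiag : ∀ N : ℕ, ∑ p ∈ Finset.HasAntidiagonal.antidiagonal N, f p = 2 * (harm 1 (N + 1) / ((N : ℝ) + 2) ^ 2) := by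
    intro N
    have e : ∀ p ∈ Finset.HasAntidiagonal.antidiagonal N, f p =
        (1 / ((p.1 : ℝ) + 1) + 1 / ((p.2 : ℝ) + 1)) / ((N : ℝ) + 2) ^ 2 := by
      intro p hp
      have : (N : ℝ) = p.1 + p.2 := by
        rw [← Finset.HasAntidiagonal.mem_antidiagonal.1 hp]; push_cast; rfl
      simp only [f]
      rw [this]
      field_simp
      ring
    have h3 : ∑ p ∈ Finset.HasAntidiagonal.antidiagonal N, 1 / ((p.1 : ℝ) + 1) = harm 1 (N + 1) := by
      rw [Finset.Nat.sum_antidiagonal_eq_sum_range_succ_mk]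
      simp [harm]
    have h4 : ∑ p ∈ Finset.HasAntidiagonal.antidiagonal N, 1 / ((p.2 : ℝ) + 1) = harm 1 (N + 1) := by
      rw [← h3, ← Finset.Nat.sum_antidiagonal_swap]
      rfl
    rw [Finset.sum_congr rfl e, ← Finset.sum_div, Finset.sum_add_distrib, h3, h4]
    ring
  have h2 : ∑' p, f p = 2 * S := by
    have hf' := Finset.HasAntidiagonal.sigmaAntidiagonalEquivProd.summable_iff.2 hf
    refine (Finset.HasAntidiagonal.sigmaAntidiagonalEquivProd.tsum_eq f).symm.trans ?_
    change ∑' p, (f ∘ Finset.HasAntidiagonal.sigmaAntidiagonalEquivProd) p = _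
    rw [Summable.tsum_sigma' (fun N => (hasSum_fintype _).summable) hf']
    have hS' : HasSum (fun N : ℕ => harm 1 (N + 1) / ((N : ℝ) + 2) ^ 2) S := by
      have := (hasSum_nat_add_iff' 1).2 hs
      simp only [Finset.sum_range_one, harm_zero, zero_div, sub_zero] at this
      convert! this using 3
      push_cast
      ring
    rw [← (hS'.mul_left 2).tsum_eq]
    congr 1
    ext N
    rw [← hdiag, tsum_fintype, Finset.univ_eq_attach]
    exact Finset.sum_attach (Finset.HasAntidiagonal.antidiagonal N) f
  have : S = zetaThree := by linarith
  rwa [this] at hs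

lemma abs_le_harm_cube {C y : ℝ} {n : ℕ} (h : |y| ≤ C * (1 + harm 1 n) ^ 3) :
    |y / (((n : ℝ) + 1) * (n + 2))| ≤ C * ((1 + harm 1 n) ^ 3 / (((n : ℝ) + 1) * (n + 2))) := by
  rw [abs_div, abs_of_pos (by positivity : (0 : ℝ) < ((n : ℝ) + 1) * (n + 2)), ← mul_div_assoc]
  exact div_le_div_of_nonneg_right h (by positivity)

lemma hasSum_inv_mul : HasSum (fun n : ℕ => 1 / (((n : ℝ) + 1) * (n + 2))) 1 := by
  have h := hasSum_inv_mul_shift 0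
  simpa [harm] using h

lemma hasSum_telescope' {f g : ℕ → ℝ} {c : ℝ} (hg : Summable g) (h : Tendsto f atTop (𝓝 0))
    (hfg : ∀ n, g n = f n - f (n + 1)) (hc : f 0 = c) : HasSum g c := by
  have e : g = fun n => f n - f (n + 1) := funext hfg
  rw [e] at hg ⊢
  exact hc ▸ hasSum_telescope hg h

lemma hasSum_harm_div : HasSum (fun n : ℕ => harm 1 n / (((n : ℝ) + 1) * (n + 2))) 1 := by
  have hs : Summable (fun n : ℕ => harm 1 n / (((n : ℝ) + 1) * (n + 2))) := by
    refine summable_of_le_harm_cube 1 fun n => abs_le_harm_cube ?_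
    have h0 := harm_nonneg 1 n
    rw [abs_of_nonneg h0]
    nlinarith [pow_nonneg h0 3, sq_nonneg (harm 1 n)]
  have h := (tendsto_harm_div.add tendsto_inv_succ)
  rw [add_zero] at h
  refine hasSum_telescope' hs h (fun n => ?_) (by simp [harm_zero])
  rw [harm_succ]
  push_cast
  field_simp
  ring

/-- The first-order coefficient in the expansion of the terms of `partsSum`. -/
noncomputable def linCoeff (n : ℕ) : ℝ := -harm 1 n - 1 + 1 / ((n : ℝ) + 1) + 2 / ((n : ℝ) + 2)

/-- The second-order coefficient in the expansion of the logarithms of the terms of `partsSum`. -/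
noncomputable def quadCoeff (n : ℕ) : ℝ :=
  harm 2 n / 2 + 3 / 2 / ((n : ℝ) + 1) ^ 2 - 3 / 2 + 2 / ((n : ℝ) + 2) ^ 2

lemma abs_linCoeff_le (n : ℕ) : |linCoeff n| ≤ 2 * (1 + harm 1 n) := by
  have h0 := harm_nonneg 1 n
  have hn : (0 : ℝ) ≤ n := n.cast_nonneg
  have h1 : 1 / ((n : ℝ) + 1) ≤ 1 := div_le_one_of_le₀ (by linarith) (by linarith)
  have h2 : 2 / ((n : ℝ) + 2) ≤ 1 := div_le_one_of_le₀ (by linarith) (by linarith)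
  have h3 : 0 ≤ 1 / ((n : ℝ) + 1) := by positivity
  have h4 : 0 ≤ 2 / ((n : ℝ) + 2) := by positivity
  unfold linCoeff
  rw [abs_le]
  constructor <;> linarith

lemma abs_quadCoeff_le (n : ℕ) : |quadCoeff n| ≤ 3 := by
  have h0 := harm_nonneg 2 n
  have h5 := harm_two_le n
  have hn : (0 : ℝ) ≤ n := n.cast_nonneg
  have h1 : 3 / 2 / ((n : ℝ) + 1) ^ 2 ≤ 3 / 2 := div_le_self (by norm_num) (by nlinarith)
  have h2 : 2 / ((n : ℝ) + 2) ^ 2 ≤ 1 := div_le_one_of_le₀ (by nlinarith) (by positivity)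
  have h3 : 0 ≤ 3 / 2 / ((n : ℝ) + 1) ^ 2 := by positivity
  have h4 : 0 ≤ 2 / ((n : ℝ) + 2) ^ 2 := by positivity
  unfold quadCoeff
  rw [abs_le]
  constructor <;> linarith

/-- After adding 1/(n + 1)² the term is a difference of 2/(n + 1)² - (Hₙ + 1)/(n + 1), whose value
at 0 is 1. -/
lemma hasSum_linCoeff :
    HasSum (fun n : ℕ => linCoeff n / (((n : ℝ) + 1) * (n + 2))) (1 - Real.pi ^ 2 / 6) := by
  have hs : Summable (fun n : ℕ => linCoeff n / (((n : ℝ) + 1) * (n + 2))) := by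
    refine summable_of_le_harm_cube 2 fun n => abs_le_harm_cube ((abs_linCoeff_le n).trans ?_)
    have h0 := harm_nonneg 1 n
    nlinarith [pow_nonneg h0 3, sq_nonneg (harm 1 n)]
  have h := (((tendsto_inv_succ.pow 2).const_mul 2).sub tendsto_harm_div).sub tendsto_inv_succ
  norm_num only [ne_eq, OfNat.ofNat_ne_zero, not_false_eq_true, zero_pow, mul_zero, sub_zero] at h
  have h2 := hasSum_telescope' (c := 1) (hs.add hasSum_inv_succ_sq.summable) h (fun n => ?_)
    (by simp [harm_zero]; norm_num)
  · simpa using h2.sub hasSum_inv_succ_sq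
  · unfold linCoeff
    simp only [harm_succ]
    push_cast
    field_simp
    ring

/-- Adding `harm 1 n` to the numerator gives a term that telescopes modulo 2/(n + 1)² - 2/(n + 1)³ +
Hₙ/(n + 1)²; by Euler's sum the latter contributes 2ζ(2) - ζ(3). The added series has sum 1 by
`hasSum_harm_div` and is subtracted later. -/
lemma hasSum_quadCoeff :
    HasSum (fun n : ℕ => (linCoeff n ^ 2 / 2 + quadCoeff n + harm 1 n) / (((n : ℝ) + 1) * (n + 2)))
      (1 + Real.pi ^ 2 / 3 - zetaThree) := by
  have hs : Summable (fun n : ℕ =>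
      (linCoeff n ^ 2 / 2 + quadCoeff n + harm 1 n) / (((n : ℝ) + 1) * (n + 2))) := by
    refine summable_of_le_harm_cube 6 fun n => abs_le_harm_cube ?_
    have h0 := harm_nonneg 1 n
    have h1 : linCoeff n ^ 2 ≤ (2 * (1 + harm 1 n)) ^ 2 := by
      rw [← sq_abs (linCoeff n)]
      exact pow_le_pow_left₀ (abs_nonneg _) (abs_linCoeff_le n) 2
    have h2 := abs_le.1 (abs_quadCoeff_le n)
    rw [abs_le]
    constructor <;> nlinarith [pow_nonneg h0 3, sq_nonneg (harm 1 n), sq_nonneg (linCoeff n)]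
  have hz := ((hasSum_inv_succ_sq.mul_left 2).sub (hasSum_zetaThree.mul_left 2)).add
    hasSum_harm_div_sq
  have h := (((((((tendsto_harm_sq_div.div_const 2).add (tendsto_harm_two_div.div_const 2)).add
    (tendsto_harm_div.const_mul 2)).sub ((tendsto_harm_div.mul tendsto_inv_succ).const_mul 2)).sub
    tendsto_inv_succ).sub ((tendsto_inv_succ.pow 2).const_mul 2)).add
    ((tendsto_inv_succ.pow 3).const_mul 4))
  norm_num only [ne_eq, OfNat.ofNat_ne_zero, not_false_eq_true, zero_pow, mul_zero, sub_zero,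
    zero_div, add_zero] at h
  have h2 := hasSum_telescope' (c := 1) (hs.sub hz.summable) h (fun n => ?_)
    (by simp [harm_zero]; norm_num)
  · convert! h2.add hz using 1
    · ext n; ring
    · ring
  · unfold linCoeff quadCoeff
    simp only [harm_succ]
    push_cast
    field_simp
    ring

/-! ### Uniform expansion of the reduced series. -/

lemma abs_log_one_sub_add_le {x : ℝ} (h0 : 0 ≤ x) (h1 : x ≤ 1 / 2) :
    |Real.log (1 - x) + x| ≤ 2 * x ^ 2 := by
  have h := Real.abs_log_sub_add_sum_range_le (x := x) (by rw [abs_of_nonneg h0]; linarith) 1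
  simp only [Finset.sum_range_one, Nat.cast_zero, zero_add, pow_one, div_one, abs_of_nonneg h0] at h
  rw [add_comm]
  refine h.trans ?_
  rw [div_le_iff₀ (by linarith)]
  norm_num
  nlinarith [sq_nonneg x]

lemma abs_log_one_sub_add_add_le {x : ℝ} (h0 : 0 ≤ x) (h1 : x ≤ 1 / 2) :
    |Real.log (1 - x) + x + x ^ 2 / 2| ≤ 2 * x ^ 3 := by
  have h := Real.abs_log_sub_add_sum_range_le (x := x) (by rw [abs_of_nonneg h0]; linarith) 2
  simp only [Finset.sum_range_succ, Finset.sum_range_zero, Nat.cast_zero, zero_add, pow_one,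
    div_one, abs_of_nonneg h0, Nat.cast_one, one_add_one_eq_two] at h
  rw [show Real.log (1 - x) + x + x ^ 2 / 2 = x + x ^ 2 / 2 + Real.log (1 - x) by ring]
  refine h.trans ?_
  rw [div_le_iff₀ (by linarith)]
  norm_num
  nlinarith [pow_nonneg h0 3]

/-- No lower bound on x is assumed: the logarithms it is applied to contain -e Hₙ, unbounded below
in n for fixed e > 0. -/
lemma abs_exp_sub_le {x : ℝ} (h : x ≤ 1) : |Real.exp x - (1 + x + x ^ 2 / 2)| ≤ 4 * |x| ^ 3 := by
  rcases le_or_gt (-1) x with h1 | h1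
  · have hb := Real.exp_bound (x := x) (abs_le.2 ⟨h1, h⟩) (n := 3) (by norm_num)
    simp only [Finset.sum_range_succ, Finset.sum_range_zero] at hb
    norm_num [Nat.factorial] at hb
    nlinarith [pow_nonneg (abs_nonneg x) 3]
  · have e1 := Real.exp_pos x
    have e2 : Real.exp x ≤ 1 := Real.exp_le_one_iff.2 (by linarith)
    rw [abs_of_neg (by linarith : x < 0), abs_le]
    have h3 : 0 < -x - 1 := by linarith
    constructor <;> nlinarith [mul_pos h3 h3, mul_pos (mul_pos h3 h3) h3]

/-- The approximate logarithm of `pochRatio e (e - t) n * pochWeight e n`. -/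
noncomputable def logApprox (e t : ℝ) (n : ℕ) : ℝ :=
  (-harm 1 n - 1 + 1 / ((n : ℝ) + 1)) * e +
    (harm 2 n / 2 + 3 / 2 / ((n : ℝ) + 1) ^ 2 - 3 / 2) * e ^ 2 + harm 1 n * t

/-- With v = e - t the denominators of R become k + 1 - t, so each step multiplies by factors 1 -
O(e)/(k + 1) or 1 - t/(k + 1) and their inverses. The Taylor remainders add up to at most 24 e³ / (k
+ 1)², the t² remainder being absorbed through t ≤ 2e². -/
lemma abs_log_pochRatio_mul_pochWeight_sub_le {e t : ℝ} (h0 : 0 ≤ e) (he : e ≤ 1 / 10)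
    (ht : 0 ≤ t) (hte : t ≤ 2 * e ^ 2) (n : ℕ) :
    |Real.log (pochRatio e (e - t) n * pochWeight e n) - logApprox e t n| ≤
      30 * e ^ 3 * harm 2 n := by
  have het : t ≤ e := by nlinarith
  induction n with
  | zero => simp [pochRatio, pochWeight, logApprox, harm_zero]
  | succ n ih =>
    have hn : (0 : ℝ) ≤ n := n.cast_nonneg
    have hj : (0 : ℝ) < (n : ℝ) + 1 := by linarith
    have hj' : (0 : ℝ) < (n : ℝ) + 2 := by linarith
    have hx : e / (n + 1) ≤ e := div_le_self h0 (by linarith)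
    have hy : t / (n + 1) ≤ t := div_le_self ht (by linarith)
    have hz : e / (n + 2) ≤ e := div_le_self h0 (by linarith)
    have hw : 2 * e / (n + 2) ≤ 2 * e := div_le_self (by linarith) (by linarith)
    have a1 := abs_log_one_sub_add_add_le (x := e / (n + 1)) (by positivity) (by linarith)
    have a2 := abs_log_one_sub_add_le (x := t / (n + 1)) (by positivity) (by linarith)
    have a3 := abs_log_one_sub_add_add_le (x := e / (n + 2)) (by positivity) (by linarith)
    have a4 := abs_log_one_sub_add_add_le (x := 2 * e / (n + 2)) (by positivity) (by linarith)
    have hpos := mul_pos (pochRatio_pos (by linarith : e ≤ 1 / 2) (by linarith : 0 ≤ e - t) n)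
      (pochWeight_pos (by linarith : e ≤ 1 / 2) n)
    have p1 : 0 < 1 - e / (n + 1) := by linarith
    have p2 : 0 < 1 - t / (n + 1) := by linarith
    have p3 : 0 < 1 - e / (n + 2) := by linarith
    have p4 : 0 < 1 - 2 * e / (n + 2) := by linarith
    have hfac : pochRatio e (e - t) (n + 1) * pochWeight e (n + 1) =
        pochRatio e (e - t) n * pochWeight e n *
          ((1 - e / (n + 1)) * (1 - e / (n + 1)) * (1 - e / (n + 2)) /
            ((1 - t / (n + 1)) * (1 - 2 * e / (n + 2)))) := by
      have q1 : (1 - e / ((n : ℝ) + 1)) = (n + 1 - e) / (n + 1) := by field_simp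
      have q2 : (1 - t / ((n : ℝ) + 1)) = (n + 1 - t) / (n + 1) := by field_simp
      have q3 : (1 - e / ((n : ℝ) + 2)) = (n + 2 - e) / (n + 2) := by field_simp
      have q4 : (1 - 2 * e / ((n : ℝ) + 2)) = (n + 2 - 2 * e) / (n + 2) := by field_simp
      have r2 : (n : ℝ) + 1 - t ≠ 0 := by linarith
      obtain ⟨d, hd⟩ : ∃ d : ℝ, d = n + 2 - 2 * e := ⟨_, rfl⟩
      have r4 : d ≠ 0 := by linarith
      rw [pochRatio_succ, pochWeight_succ, q1, q2, q3, q4,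
        show (n : ℝ) + 1 - e + (e - t) = n + 1 - t by ring, ← hd]
      field_simp
    have hlog : Real.log (pochRatio e (e - t) (n + 1) * pochWeight e (n + 1)) =
        Real.log (pochRatio e (e - t) n * pochWeight e n) + (2 * Real.log (1 - e / (n + 1)) +
          Real.log (1 - e / (n + 2)) - Real.log (1 - t / (n + 1))
            - Real.log (1 - 2 * e / (n + 2))) := by
      rw [hfac, Real.log_mul hpos.ne' (by positivity), Real.log_div (by positivity) (by positivity),
        Real.log_mul (by positivity) p3.ne', Real.log_mul p1.ne' p1.ne',
        Real.log_mul p2.ne' p4.ne']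
      ring
    have happ : logApprox e t (n + 1) = logApprox e t n +
        (2 * (-(e / (n + 1)) - (e / (n + 1)) ^ 2 / 2) + (-(e / (n + 2)) - (e / (n + 2)) ^ 2 / 2)
          + t / (n + 1) + (2 * e / (n + 2) + (2 * e / (n + 2)) ^ 2 / 2)) := by
      unfold logApprox
      simp only [harm_succ]
      push_cast
      field_simp
      ring
    have hsq : ((n : ℝ) + 1) ^ 2 ≤ (n + 1) ^ 3 := by nlinarith [sq_nonneg ((n : ℝ) + 1)]
    have hsq' : ((n : ℝ) + 1) ^ 2 ≤ (n + 2) ^ 3 :=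
      hsq.trans (pow_le_pow_left₀ hj.le (by linarith) 3)
    have e3 : 0 ≤ e ^ 3 := by positivity
    have b1 : (e / ((n : ℝ) + 1)) ^ 3 ≤ e ^ 3 * (1 / ((n : ℝ) + 1) ^ 2) := by
      rw [div_pow, mul_one_div]
      exact div_le_div_of_nonneg_left e3 (by positivity) hsq
    have b3 : (e / ((n : ℝ) + 2)) ^ 3 ≤ e ^ 3 * (1 / ((n : ℝ) + 1) ^ 2) := by
      rw [div_pow, mul_one_div]
      exact div_le_div_of_nonneg_left e3 (by positivity) hsq'
    have b4 : (2 * e / ((n : ℝ) + 2)) ^ 3 ≤ 8 * (e ^ 3 * (1 / ((n : ℝ) + 1) ^ 2)) := by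
      rw [mul_div_assoc, mul_pow]
      linarith
    have b2 : (t / ((n : ℝ) + 1)) ^ 2 ≤ e ^ 3 * (1 / ((n : ℝ) + 1) ^ 2) := by
      rw [div_pow, mul_one_div]
      refine div_le_div_of_nonneg_right ?_ (by positivity)
      have : t ^ 2 ≤ (2 * e ^ 2) ^ 2 := pow_le_pow_left₀ ht hte 2
      nlinarith
    have b0 : 0 ≤ e ^ 3 * (1 / ((n : ℝ) + 1) ^ 2) := by positivity
    rw [hlog, happ, harm_succ]
    rw [abs_le] at *
    constructor <;> linarith [ih.1, ih.2, a1.1, a1.2, a2.1, a2.2, a3.1, a3.2, a4.1, a4.2]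

-- Exponentiates the logarithmic expansion: the logarithm L is `linCoeff n * e` plus O((1 + Hₙ) e²),
-- so L²/2 may be replaced by (`linCoeff n * e`)²/2, and every error is at most a multiple of e³ (1
-- + Hₙ)³.
set_option maxHeartbeats 1000000 in
lemma abs_partsTerm_sub_le {e t : ℝ} (h0 : 0 ≤ e) (he : e ≤ 1 / 10)
    (ht : 0 ≤ t) (hte : t ≤ 2 * e ^ 2) (n : ℕ) :
    |partsTerm e (e - t) n - (1 + linCoeff n * e + (linCoeff n ^ 2 / 2 + quadCoeff n) * e ^ 2
      + harm 1 n * t) / (((n : ℝ) + 1) * (n + 2))| ≤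
      1000 * e ^ 3 * ((1 + harm 1 n) ^ 3 / (((n : ℝ) + 1) * (n + 2))) := by
  have hn : (0 : ℝ) ≤ n := n.cast_nonneg
  have het : t ≤ e := by nlinarith
  have hE := mul_pos (pochRatio_pos (by linarith : e ≤ 1 / 2) (by linarith : 0 ≤ e - t) n)
      (pochWeight_pos (by linarith : e ≤ 1 / 2) n)
  have hE1 := pochRatio_mul_pochWeight_le_one h0 (by linarith : e ≤ 1 / 2)
    (by linarith : 0 ≤ e - t) n
  have hlog := abs_log_pochRatio_mul_pochWeight_sub_le h0 he ht hte n
  have hw : 2 * e / (n + 2) ≤ e := by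
    rw [div_le_iff₀ (by linarith)]
    nlinarith
  have p4 : 0 < 1 - 2 * e / (n + 2) := by linarith
  have a4 := abs_log_one_sub_add_add_le (x := 2 * e / (n + 2)) (by positivity) (by linarith)
  have hR : partsTerm e (e - t) n =
      pochRatio e (e - t) n * pochWeight e n / (1 - 2 * e / (n + 2)) / ((n + 1) * (n + 2)) := by
    obtain ⟨d, hd⟩ : ∃ d : ℝ, d = n + 2 - 2 * e := ⟨_, rfl⟩
    have r4 : d ≠ 0 := by linarith
    have q4 : (1 - 2 * e / ((n : ℝ) + 2)) = d / (n + 2) := by rw [hd]; field_simp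
    unfold partsTerm
    rw [q4, ← hd]
    field_simp
  rw [hR, ← sub_div]
  refine abs_le_harm_cube (C := 1000 * e ^ 3) ?_
  generalize hEE : pochRatio e (e - t) n * pochWeight e n = E at *
  set h := 1 + harm 1 n with hh
  have hh1 : 1 ≤ h := by linarith [harm_nonneg 1 n]
  set L := Real.log (E / (1 - 2 * e / (n + 2))) with hL
  have hexp : E / (1 - 2 * e / (n + 2)) = Real.exp L := (Real.exp_log (by positivity)).symm
  have hL1 : L ≤ 1 := by
    have h1 : Real.log E ≤ 0 := Real.log_nonpos hE.le hE1
    have h2 : L = Real.log E - Real.log (1 - 2 * e / (n + 2)) := Real.log_div hE.ne' p4.ne'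
    have h3 := Real.one_sub_inv_le_log_of_pos p4
    have h4 : (1 - 2 * e / ((n : ℝ) + 2))⁻¹ ≤ 2 := by
      rw [inv_le_comm₀ p4 (by norm_num)]
      linarith
    linarith
  have e3 : 0 ≤ e ^ 3 := by positivity
  have hLM : |L - (linCoeff n * e + quadCoeff n * e ^ 2 + harm 1 n * t)| ≤ 66 * e ^ 3 := by
    have h2 : L = Real.log E - Real.log (1 - 2 * e / (n + 2)) := Real.log_div hE.ne' p4.ne'
    have h3 : linCoeff n * e + quadCoeff n * e ^ 2 + harm 1 n * t = logApprox e t n +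
        (2 * e / (n + 2) + (2 * e / (n + 2)) ^ 2 / 2) := by
      unfold linCoeff quadCoeff logApprox
      field_simp
      ring
    have h4 : (2 * e / ((n : ℝ) + 2)) ^ 3 ≤ e ^ 3 := pow_le_pow_left₀ (by positivity) hw 3
    have h5 : 30 * e ^ 3 * harm 2 n ≤ 30 * e ^ 3 * (5 / 3) :=
      mul_le_mul_of_nonneg_left (harm_two_le n) (by positivity)
    rw [h2, h3]
    rw [abs_le] at *
    constructor <;> linarith [hlog.1, hlog.2, a4.1, a4.2]
  have hX := abs_linCoeff_le n
  have hY := abs_quadCoeff_le n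
  rw [← hh] at hX
  have hH : |harm 1 n * t| ≤ 2 * h * e ^ 2 := by
    rw [abs_of_nonneg (mul_nonneg (harm_nonneg 1 n) ht)]
    calc harm 1 n * t ≤ h * (2 * e ^ 2) :=
          mul_le_mul (by linarith) hte ht (by linarith)
      _ = _ := by ring
  have hXe : |linCoeff n * e| ≤ 2 * h * e := by
    rw [abs_mul, abs_of_nonneg h0]
    exact mul_le_mul_of_nonneg_right hX h0
  have hYe : |quadCoeff n * e ^ 2| ≤ 3 * h * e ^ 2 := by
    rw [abs_mul, abs_of_nonneg (sq_nonneg e)]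
    exact mul_le_mul_of_nonneg_right (by linarith) (sq_nonneg e)
  have he2 : e ^ 3 ≤ h * e ^ 2 / 10 := by nlinarith [sq_nonneg e, mul_nonneg (sq_nonneg e) h0]
  have hdiff : |L - linCoeff n * e| ≤ 12 * h * e ^ 2 := by
    rw [abs_le] at *
    constructor <;> linarith [hLM.1, hLM.2, hH.1, hH.2, hYe.1, hYe.2]
  have he1 : h * e ^ 2 ≤ h * e / 10 := by
    nlinarith [mul_nonneg (by linarith : 0 ≤ h) (mul_nonneg h0 (by linarith : 0 ≤ 1 / 10 - e))]
  have hLe : |L| ≤ 4 * h * e := by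
    rw [abs_le] at *
    constructor <;> linarith [hdiff.1, hdiff.2, hXe.1, hXe.2]
  have hL3 : |L| ^ 3 ≤ 64 * (e ^ 3 * h ^ 3) :=
    (pow_le_pow_left₀ (abs_nonneg L) hLe 3).trans_eq (by ring)
  have hsq : |(L - linCoeff n * e) * (L + linCoeff n * e)| ≤ 72 * (e ^ 3 * h ^ 3) := by
    rw [abs_mul]
    have h1 : |L + linCoeff n * e| ≤ 6 * h * e := (abs_add_le _ _).trans (by linarith)
    have h2 : h ^ 2 ≤ h ^ 3 := pow_le_pow_right₀ hh1 (by norm_num)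
    calc _ ≤ 12 * h * e ^ 2 * (6 * h * e) :=
          mul_le_mul hdiff h1 (abs_nonneg _) (by positivity)
      _ = 72 * (e ^ 3 * h ^ 2) := by ring
      _ ≤ _ := by gcongr
  have hc : e ^ 3 ≤ e ^ 3 * h ^ 3 := le_mul_of_one_le_right e3 (one_le_pow₀ hh1)
  have hx := abs_exp_sub_le hL1
  rw [hexp, mul_assoc]
  rw [abs_le] at hx hsq hLM ⊢
  constructor <;> linarith [hx.1, hx.2, hsq.1, hsq.2, hLM.1, hLM.2]

lemma exists_abs_partsSum_sub_le : ∃ K : ℝ, 0 ≤ K ∧ ∀ e t : ℝ, 0 ≤ e → e ≤ 1 / 10 → 0 ≤ t →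
    t ≤ 2 * e ^ 2 → |partsSum e (e - t) - (1 + (1 - Real.pi ^ 2 / 6) * e +
      (Real.pi ^ 2 / 3 - zetaThree) * e ^ 2 + t)| ≤ K * e ^ 3 := by
  refine ⟨1000 * ∑' n : ℕ, (1 + harm 1 n) ^ 3 / (((n : ℝ) + 1) * (n + 2)), ?_, ?_⟩
  · refine mul_nonneg (by norm_num) (tsum_nonneg fun n => ?_)
    have := harm_nonneg 1 n
    positivity
  · intro e t h0 he ht hte
    have hmain := ((hasSum_inv_mul.add (hasSum_linCoeff.mul_right e)).add
      ((hasSum_quadCoeff.sub hasSum_harm_div).mul_right (e ^ 2))).add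
        (hasSum_harm_div.mul_right t)
    have hT := (summable_partsTerm h0 (by linarith : e ≤ 1 / 2)
      (by nlinarith : 0 ≤ e - t)).hasSum
    have hd := hT.sub hmain
    have hb := (summable_harm_cube.hasSum.mul_left (1000 * e ^ 3))
    have hle : ∀ n : ℕ, |partsTerm e (e - t) n - (1 / (((n : ℝ) + 1) * (n + 2)) +
        linCoeff n / (((n : ℝ) + 1) * (n + 2)) * e +
        ((linCoeff n ^ 2 / 2 + quadCoeff n + harm 1 n) / (((n : ℝ) + 1) * (n + 2)) -
          harm 1 n / (((n : ℝ) + 1) * (n + 2))) * e ^ 2 +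
        harm 1 n / (((n : ℝ) + 1) * (n + 2)) * t)| ≤
        1000 * e ^ 3 * ((1 + harm 1 n) ^ 3 / (((n : ℝ) + 1) * (n + 2))) := by
      intro n
      refine (le_of_eq (congrArg _ ?_)).trans (abs_partsTerm_sub_le h0 he ht hte n)
      ring
    have h1 := hasSum_le (fun n => (abs_le.1 (hle n)).2) hd hb
    have h2 := hasSum_le (fun n => (abs_le.1 (hle n)).1) hb.neg hd
    rw [abs_le]
    unfold partsSum
    constructor <;> linarith

/-! ### Inversion and conclusion. -/

/-- Inversion of a perturbed quartic at the origin. -/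
lemma isBigO_sub_of_quartic {e : ℝ → ℝ} {a b : ℝ} (he : e =O[𝓝[>] (0 : ℝ)] (fun v : ℝ => v))
    (h : (fun v => v - (e v - e v ^ 2 - a * e v ^ 3 - b * e v ^ 4)) =O[𝓝[>] (0 : ℝ)]
      (fun v : ℝ => v ^ 5)) :
    (fun v => e v - (v + v ^ 2 + (2 + a) * v ^ 3 + (5 + 5 * a + b) * v ^ 4)) =O[𝓝[>] (0 : ℝ)]
      (fun v : ℝ => v ^ 5) := by
  set p : ℝ → ℝ := fun v => v + v ^ 2 + (2 + a) * v ^ 3 + (5 + 5 * a + b) * v ^ 4 with hp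
  have hid : Tendsto (fun v : ℝ => v) (𝓝[>] 0) (𝓝 0) := tendsto_nhdsWithin_of_tendsto_nhds tendsto_id
  have he0 : Tendsto e (𝓝[>] 0) (𝓝 0) := he.trans_tendsto hid
  have hp0 : Tendsto p (𝓝[>] 0) (𝓝 0) := by
    have : Continuous p := by fun_prop
    have h2 := (this.tendsto 0).mono_left (nhdsWithin_le_nhds (s := Set.Ioi 0))
    simpa [hp] using h2
  have hP : (fun v => v - (p v - p v ^ 2 - a * p v ^ 3 - b * p v ^ 4)) =O[𝓝[>] (0 : ℝ)]
      (fun v : ℝ => v ^ 5) := by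
    -- Here p(v) = v + v² w(v), and g is the explicit cofactor of v⁵ in v - Q(p(v)), Q being the
    -- quartic.
    let c : ℝ → ℝ := fun v => (2 + a) + (5 + 5 * a + b) * v
    let w : ℝ → ℝ := fun v => 1 + c v * v
    let g : ℝ → ℝ := fun v => 2 * (5 + 5 * a + b) + c v * (w v + 1)
      + a * (3 * c v + 3 * w v ^ 2 + v * w v ^ 3)
      + b * (4 * w v + 6 * v * w v ^ 2 + 4 * v ^ 2 * w v ^ 3 + v ^ 3 * w v ^ 4)
    have hg : g =O[𝓝[>] (0 : ℝ)] (fun _ : ℝ => (1 : ℝ)) := by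
      have : Continuous g := by fun_prop
      exact ((this.tendsto 0).mono_left nhdsWithin_le_nhds).isBigO_one ℝ
    have h2 := hg.mul (isBigO_refl (fun v : ℝ => v ^ 5) (𝓝[>] 0))
    simp only [one_mul] at h2
    refine h2.congr_left fun v => ?_
    simp only [g, w, c, hp]
    ring
  -- Divided difference: Q(e) - Q(p) = (e - p) r with r → 1, so e - p is as small as Q(e) - Q(p).
  let r : ℝ → ℝ := fun v => 1 - (e v + p v) - a * (e v ^ 2 + e v * p v + p v ^ 2)
    - b * (e v ^ 3 + e v ^ 2 * p v + e v * p v ^ 2 + p v ^ 3)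
  have hr : Tendsto r (𝓝[>] 0) (𝓝 1) := by
    have := (((he0.add hp0).const_sub 1).sub
      ((((he0.pow 2).add (he0.mul hp0)).add (hp0.pow 2)).const_mul a)).sub
      (((((he0.pow 3).add ((he0.pow 2).mul hp0)).add (he0.mul (hp0.pow 2))).add
        (hp0.pow 3)).const_mul b)
    simpa using this
  have hri : (fun v => (r v)⁻¹) =O[𝓝[>] (0 : ℝ)] (fun _ : ℝ => (1 : ℝ)) :=
    (hr.inv₀ one_ne_zero).isBigO_one ℝ
  have h3 := hri.mul (hP.sub h)
  simp only [one_mul] at h3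
  refine h3.congr' ?_ EventuallyEq.rfl
  filter_upwards [hr.eventually_ne one_ne_zero] with v hv
  rw [inv_mul_eq_iff_eq_mul₀ hv]
  simp only [r]
  ring

lemma le_and_le_of_zeroEqn {e v : ℝ} (h0 : 0 < e) (he : e < 1 / 2) (hv : 0 < v)
    (h : zeroEqn v e = v) : v ≤ e ∧ e ≤ 2 * v ∧ e - v ≤ 2 * e ^ 2 := by
  have h1 := partsSum_le h0.le he.le hv.le
  have h2 := partsSum_nonneg he.le hv.le
  have h3 : 0 ≤ e ^ 2 * (1 - e) := mul_nonneg (sq_nonneg e) (by linarith)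
  have h4 : e ^ 2 * (1 - e) * partsSum e v ≤ e ^ 2 * (1 - e) * (5 / 3) :=
    mul_le_mul_of_nonneg_left h1 h3
  have h5 := mul_nonneg h3 h2
  unfold zeroEqn at h
  refine ⟨by linarith, ?_, ?_⟩
  · nlinarith [mul_nonneg h0.le (sq_nonneg (e - 1 / 2))]
  · nlinarith [pow_pos h0 3, sq_nonneg e]

/-- Bootstrap: t = O(e²) gives T = 1 + O(e), hence t = e² (1 - e) T = e² + O(e³). Replacing t by e²
in the expansion of T leaves a polynomial in e alone. -/
lemma exists_abs_sub_quartic_le : ∃ K : ℝ, 0 ≤ K ∧ ∀ e v : ℝ, 0 < e → e ≤ 1 / 10 → 0 < v →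
    zeroEqn v e = v → |v - (e - e ^ 2 - (-(Real.pi ^ 2 / 6)) * e ^ 3 -
      (3 * (Real.pi ^ 2 / 6) - zetaThree) * e ^ 4)| ≤ K * e ^ 5 := by
  obtain ⟨K, hK, h⟩ := exists_abs_partsSum_sub_le
  set z := Real.pi ^ 2 / 6 with hz
  set q := 1 + 2 * z - zetaThree with hq
  have hpi : Real.pi ^ 2 / 3 = 2 * z := by rw [hz]; ring
  rw [hpi] at h
  set K₁ := K + |1 - z| + |2 * z - zetaThree| + 2 with hK₁
  refine ⟨K + K₁ + 1 + |q|, by positivity, fun e v h0 he hv heq => ?_⟩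
  obtain ⟨hve, -, hev⟩ := le_and_le_of_zeroEqn h0 (by linarith) hv heq
  have hT := h e (e - v) h0.le he (by linarith) hev
  rw [sub_sub_cancel] at hT
  have ht : e - v = e ^ 2 * (1 - e) * partsSum e v := by
    unfold zeroEqn at heq; linarith
  generalize partsSum e v = T at *
  have he2 : e ^ 2 ≤ e := by nlinarith
  have he3 : e ^ 3 ≤ e := by nlinarith [sq_nonneg e]
  have hT1 : |T - 1| ≤ K₁ * e := by
    have e1 : T - 1 = (T - (1 + (1 - z) * e + (2 * z - zetaThree) * e ^ 2 + (e - v))) +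
        (1 - z) * e + (2 * z - zetaThree) * e ^ 2 + (e - v) := by ring
    rw [e1]
    have b1 : |(1 - z) * e| = |1 - z| * e := by rw [abs_mul, abs_of_pos h0]
    have b2 : |(2 * z - zetaThree) * e ^ 2| ≤ |2 * z - zetaThree| * e := by
      rw [abs_mul, abs_of_nonneg (sq_nonneg e)]
      exact mul_le_mul_of_nonneg_left he2 (abs_nonneg _)
    have b3 : |e - v| ≤ 2 * e := by rw [abs_of_nonneg (by linarith)]; linarith
    have b4 : K * e ^ 3 ≤ K * e := mul_le_mul_of_nonneg_left he3 hK
    refine (abs_add_le _ _).trans ?_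
    have c1 := abs_add_le (T - (1 + (1 - z) * e + (2 * z - zetaThree) * e ^ 2 + (e - v)) +
        (1 - z) * e) ((2 * z - zetaThree) * e ^ 2)
    have c2 := abs_add_le (T - (1 + (1 - z) * e + (2 * z - zetaThree) * e ^ 2 + (e - v)))
        ((1 - z) * e)
    rw [hK₁]
    linarith
  have ht2 : |e - v - e ^ 2| ≤ (K₁ + 1) * e ^ 3 := by
    have e1 : e - v - e ^ 2 = e ^ 2 * (1 - e) * (T - 1) - e ^ 3 := by rw [ht]; ring
    have b1 : |e ^ 2 * (1 - e) * (T - 1)| ≤ e ^ 2 * (K₁ * e) := by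
      rw [abs_mul, abs_of_nonneg (mul_nonneg (sq_nonneg e) (by linarith))]
      exact mul_le_mul (mul_le_of_le_one_right (sq_nonneg e) (by linarith)) hT1 (abs_nonneg _)
        (sq_nonneg e)
    have b2 : |e ^ 3| = e ^ 3 := abs_of_pos (by positivity)
    rw [e1]
    refine (abs_sub _ _).trans ?_
    rw [b2]
    linarith
  have hfin : |T - (1 + (1 - z) * e + q * e ^ 2)| ≤ (K + K₁ + 1) * e ^ 3 := by
    have e1 : T - (1 + (1 - z) * e + q * e ^ 2) =
        (T - (1 + (1 - z) * e + (2 * z - zetaThree) * e ^ 2 + (e - v))) + (e - v - e ^ 2) := by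
      rw [hq]; ring
    rw [e1]
    refine (abs_add_le _ _).trans ?_
    linarith
  have e1 : v - (e - e ^ 2 - (-z) * e ^ 3 - (3 * z - zetaThree) * e ^ 4) =
      -(e ^ 2 * (1 - e) * (T - (1 + (1 - z) * e + q * e ^ 2))) + q * e ^ 5 := by
    have : v = e - e ^ 2 * (1 - e) * T := by linarith
    rw [this, hq]
    ring
  have b1 : |e ^ 2 * (1 - e) * (T - (1 + (1 - z) * e + q * e ^ 2))| ≤
      e ^ 2 * ((K + K₁ + 1) * e ^ 3) := by
    rw [abs_mul, abs_of_nonneg (mul_nonneg (sq_nonneg e) (by linarith))]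
    exact mul_le_mul (mul_le_of_le_one_right (sq_nonneg e) (by linarith)) hfin (abs_nonneg _)
      (sq_nonneg e)
  have b2 : |q * e ^ 5| = |q| * e ^ 5 := by rw [abs_mul, abs_of_pos (pow_pos h0 5)]
  rw [e1]
  refine (abs_add_le _ _).trans ?_
  rw [abs_neg, b2]
  linarith

theorem mainTheorem7 :
    (∀ ν : ℝ, 0 < ν → ∀ x ∈ Set.Ioo (0 : ℝ) (1 / 2), Summable (charTerm ν x)) ∧
    ∃ δ : ℝ, 0 < δ ∧
      (∀ ν ∈ Set.Ioo (0 : ℝ) δ, ∃! x : ℝ, x ∈ Set.Ioo (0 : ℝ) (1 / 2) ∧ charFun3F2 ν x = 0) ∧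
      ∀ x₀ : ℝ → ℝ,
        (∀ ν ∈ Set.Ioo (0 : ℝ) δ, x₀ ν ∈ Set.Ioo (0 : ℝ) (1 / 2) ∧ charFun3F2 ν (x₀ ν) = 0) →
        (fun ν : ℝ => x₀ ν - (1 / 2 - ν - ν ^ 2 - (2 - Real.pi ^ 2 / 6) * ν ^ 3
            - (5 - Real.pi ^ 2 / 3 - (riemannZeta 3).re) * ν ^ 4))
          =O[𝓝[>] (0 : ℝ)] (fun ν : ℝ => ν ^ 5) := by
  refine ⟨fun ν hν x hx => summable_charTerm hν hx, 1 / 4, by norm_num,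
    fun ν hν => existsUnique_zero hν.1 hν.2, fun x₀ hx₀ => ?_⟩
  obtain ⟨K, hK, h⟩ := exists_abs_sub_quartic_le
  have hz : ∀ v ∈ Set.Ioo (0 : ℝ) (1 / 4), 0 < 1 / 2 - x₀ v ∧ 1 / 2 - x₀ v ≤ 2 * v ∧
      zeroEqn v (1 / 2 - x₀ v) = v := by
    intro v hv
    obtain ⟨hx, h0⟩ := hx₀ v hv
    have hzero := zeroEqn_of_charFun3F2_eq_zero hv.1 hx h0
    have h1 : 0 < 1 / 2 - x₀ v := by linarith [hx.2]
    exact ⟨h1, (le_and_le_of_zeroEqn h1 (by linarith [hx.1]) hv.1 hzero).2.1, hzero⟩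
  -- For v < 1/20 the bound e ≤ 2v gives e ≤ 1/10, the range of the expansion.
  have hmem : Set.Ioo (0 : ℝ) (1 / 20) ∈ 𝓝[>] (0 : ℝ) := Ioo_mem_nhdsGT (by norm_num)
  have hO : (fun v => 1 / 2 - x₀ v) =O[𝓝[>] (0 : ℝ)] (fun v : ℝ => v) := by
    refine IsBigO.of_bound 2 ?_
    filter_upwards [hmem] with v hv
    obtain ⟨h1, h2, -⟩ := hz v ⟨hv.1, hv.2.trans (by norm_num)⟩
    rwa [Real.norm_of_nonneg h1.le, Real.norm_of_nonneg hv.1.le]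
  have hQ : (fun v => v - ((1 / 2 - x₀ v) - (1 / 2 - x₀ v) ^ 2 -
      (-(Real.pi ^ 2 / 6)) * (1 / 2 - x₀ v) ^ 3 -
      (3 * (Real.pi ^ 2 / 6) - zetaThree) * (1 / 2 - x₀ v) ^ 4)) =O[𝓝[>] (0 : ℝ)]
      (fun v : ℝ => v ^ 5) := by
    refine IsBigO.trans (IsBigO.of_bound K ?_) (hO.pow 5)
    filter_upwards [hmem] with v hv
    obtain ⟨h1, h2, h3⟩ := hz v ⟨hv.1, hv.2.trans (by norm_num)⟩
    rw [Real.norm_of_nonneg (pow_pos h1 5).le]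
    exact h _ v h1 (by linarith [hv.2]) hv.1 h3
  refine (isBigO_sub_of_quartic hO hQ).neg_left.congr_left fun v => ?_
  rw [riemannZeta_three_re]
  ring
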